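/- Let $(\Omega,\mathcal F,\mathbb P)$ be an atomless probability space, i.e. every $A\in\mathcal F$ with $\mathbb P(A)>0$ has a subset $B\in\mathcal F$ with $0<\mathbb P(B)<\mathbb P(A)$. Let $L^1$ be the space of integrable random variables on it (almost surely equal random variables being identified, real numbers being identified with constant random variables, and inequalities being understood almost surely), and let $L^1_+=\{X\in L^1: X\ge 0\}$. Let $\rho:L^1\to(-\infty,\infty]$ be a law-invariant coherent risk measure, that is, $\rho$ is finite on constants and satisfies, for all $X,Y\in L^1$: - (monotonicity) $\rho(X)\le\rho(Y)$ if $X\le Y$; - (cash invariance) $\rho(X+c)=\rho(X)+c$ for all $c\in\mathbb R$; - (convexity) $\rho(\lambda X+(1-\lambda)Y)\le\lambda\rho(X)+(1-\lambda)\rho(Y)$ for all $\lambda\in(0,1)$; - (positive homogeneity) $\rho(\lambda X)=\lambda\rho(X)$ for all $\lambda>0$; - (law invariance) $\rho(X)=\rho(Y)$ if $X$ and $Y$ have the same distribution. Then $\rho$ is finite on $L^1$ (i.e. $\rho(X)\in\mathbb R$ for all $X\in L^1$) if and only if $\rho$ is expectation-dominated, i.e. there exists a constant $c>0$ such that $\rho(X)\le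 c\,\mathbb E[X]$ for all $X\in L^1_+$. -/

import Mathlib

open MeasureTheory ProbabilityTheory

namespace CoherentRisk

variable {Ω : Type*} [MeasurableSpace Ω]

/-- A measure is atomless if every measurable set of positive measure has a measurable subset
of strictly smaller positive measure. (Mathlib's `NullSingletonClass` is weaker.) -/
def IsAtomless (P : Measure Ω) : Prop :=
  ∀ A : Set Ω, MeasurableSet A → 0 < P A →
    ∃ B : Set Ω, B ⊆ A ∧ MeasurableSet B ∧ 0 < P B ∧ P B < P A

/-- The real number `c`, as a constant random variable in `L¹`. -/
noncomputable def constRV (P : Measure Ω) [IsFiniteMeasure P] (c : ℝ) : Lp ℝ 1 P :=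
  Lp.const 1 P c

/-- A risk measure on `L¹`: a functional with values in `(-∞, ∞]`, finite on constants. -/
structure IsRiskMeasure {P : Measure Ω} [IsFiniteMeasure P] (ρ : Lp ℝ 1 P → EReal) : Prop where
  ne_bot : ∀ X, ρ X ≠ ⊥
  const_ne_top : ∀ c : ℝ, ρ (constRV P c) ≠ ⊤

/-- A coherent risk measure on `L¹`. The order on `L¹` is the almost sure order. -/
structure IsCoherent {P : Measure Ω} [IsFiniteMeasure P] (ρ : Lp ℝ 1 P → EReal) : Prop
    extends IsRiskMeasure ρ where
  monotone : ∀ X Y : Lp ℝ 1 P, X ≤ Y → ρ X ≤ ρ Y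
  cash_invariant : ∀ (X : Lp ℝ 1 P) (c : ℝ), ρ (X + constRV P c) = ρ X + (c : EReal)
  convex : ∀ (X Y : Lp ℝ 1 P) (l : ℝ), 0 < l → l < 1 →
    ρ (l • X + (1 - l) • Y) ≤ (l : EReal) * ρ X + ((1 - l : ℝ) : EReal) * ρ Y
  pos_homogeneous : ∀ (X : Lp ℝ 1 P) (l : ℝ), 0 < l → ρ (l • X) = (l : EReal) * ρ X

/-- The value of `ρ` depends only on the distribution of its argument. -/
def IsLawInvariant {P : Measure Ω} (ρ : Lp ℝ 1 P → EReal) : Prop :=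
  ∀ X Y : Lp ℝ 1 P, IdentDistrib X Y P P → ρ X = ρ Y

/-- `ρ` takes only real values on `L¹`. -/
def IsFiniteOnL1 {P : Measure Ω} (ρ : Lp ℝ 1 P → EReal) : Prop :=
  ∀ X : Lp ℝ 1 P, ρ X ≠ ⊥ ∧ ρ X ≠ ⊤

/-- There is a constant `c > 0` with `ρ X ≤ c * 𝔼[X]` for all nonnegative `X` in `L¹`. -/
def IsExpectationDominated {P : Measure Ω} (ρ : Lp ℝ 1 P → EReal) : Prop :=
  ∃ c : ℝ, 0 < c ∧ ∀ X : Lp ℝ 1 P, 0 ≤ X → ρ X ≤ ((c * ∫ ω, X ω ∂P : ℝ) : EReal)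

end CoherentRisk

/-!
Finiteness under domination is immediate from `ρ X ≤ ρ X⁺ ≤ c 𝔼[X⁺]`, where `X⁺ = X ⊔ 0`.

For the converse, suppose that no constant works, and choose for each `n` some `Xₙ ≥ 0` with
`ρ Xₙ > 4ⁿ 𝔼[Xₙ]`. As `ρ 0 = 0`, the norm `𝔼[Xₙ]` is positive, so `Xₙ` can be rescaled to a
nonnegative `Yₙ` of norm `2⁻ⁿ` with `ρ Yₙ > 2ⁿ` (`exists_norm_eq_and_lt_of_not_dominated`).
The series `∑ Yₙ` converges in the Banach space `L¹`, and its sum `Y` dominates every `Yₙ`;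
by monotonicity `ρ Y ≥ 2ⁿ` for all `n`, so `ρ Y = ⊤`.
-/

namespace CoherentRisk

variable {Ω : Type*} [MeasurableSpace Ω] {P : Measure Ω}

theorem norm_eq_integral_of_nonneg {X : Lp ℝ 1 P} (hX : 0 ≤ X) : ‖X‖ = ∫ ω, X ω ∂P := by
  rw [L1.norm_eq_integral_norm]
  refine integral_congr_ae ?_
  filter_upwards [(Lp.coeFn_nonneg X).2 hX] with ω hω
  exact Real.norm_of_nonneg hω

theorem IsCoherent.map_zero [IsFiniteMeasure P] {ρ : Lp ℝ 1 P → EReal} (hρ : IsCoherent ρ) :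
    ρ 0 = 0 := by
  have hconst : constRV P 0 = 0 := (Lp.const 1 P).map_zero
  have htop : ρ 0 ≠ ⊤ := hconst ▸ hρ.const_ne_top 0
  have h := hρ.pos_homogeneous 0 2 two_pos
  rw [smul_zero] at h
  lift ρ 0 to ℝ using ⟨htop, hρ.ne_bot 0⟩ with a
  norm_cast at h ⊢
  linarith

/-- If `b / r` is not a domination constant, then `ρ` exceeds `b` at some nonnegative random
variable of norm `r`. -/
theorem exists_norm_eq_and_lt_of_not_dominated [IsFiniteMeasure P] {ρ : Lp ℝ 1 P → EReal}
    (hρ : IsCoherent ρ) (h : ¬ IsExpectationDominated ρ) {r b : ℝ} (hr : 0 < r) (hb : 0 < b) :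
    ∃ Y : Lp ℝ 1 P, 0 ≤ Y ∧ ‖Y‖ = r ∧ (b : EReal) < ρ Y := by
  unfold IsExpectationDominated at h
  push Not at h
  obtain ⟨X, hX, hlt⟩ := h (b / r) (by positivity)
  rw [← norm_eq_integral_of_nonneg hX] at hlt
  have hpos : 0 < ‖X‖ := by
    refine norm_pos_iff.2 fun h0 => ?_
    simp [h0, hρ.map_zero] at hlt
  have hs : 0 < r / ‖X‖ := by positivity
  refine ⟨(r / ‖X‖) • X, ?_, ?_, ?_⟩
  · rw [← Lp.coeFn_nonneg] at hX ⊢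
    filter_upwards [hX, Lp.coeFn_smul (r / ‖X‖) X] with ω hω hsmul
    rw [hsmul]
    exact mul_nonneg hs.le hω
  · rw [norm_smul, Real.norm_of_nonneg hs.le, div_mul_cancel₀ _ hpos.ne']
  · rw [hρ.pos_homogeneous X _ hs]
    have hval : b = r / ‖X‖ * (b / r * ‖X‖) := by field_simp
    rw [hval, EReal.coe_mul]
    rcases eq_or_ne (ρ X) ⊤ with htop | htop
    · rw [htop, EReal.coe_mul_top_of_pos hs, ← EReal.coe_mul]
      exact EReal.coe_lt_top _
    · lift ρ X to ℝ using ⟨htop, hρ.ne_bot X⟩ with a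
      norm_cast at hlt ⊢
      exact mul_lt_mul_of_pos_left hlt hs

theorem IsCoherent.isFiniteOnL1_of_isExpectationDominated [IsFiniteMeasure P]
    {ρ : Lp ℝ 1 P → EReal} (hρ : IsCoherent ρ) (h : IsExpectationDominated ρ) :
    IsFiniteOnL1 ρ := by
  obtain ⟨c, -, hc⟩ := h
  intro X
  have hle : ρ X ≤ ρ (X ⊔ 0) := hρ.monotone X (X ⊔ 0) le_sup_left
  exact ⟨hρ.ne_bot X, ((hle.trans (hc _ le_sup_right)).trans_lt (EReal.coe_lt_top _)).ne⟩

theorem IsCoherent.isExpectationDominated_of_isFiniteOnL1 [IsFiniteMeasure P]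
    {ρ : Lp ℝ 1 P → EReal} (hρ : IsCoherent ρ) (hfin : IsFiniteOnL1 ρ) :
    IsExpectationDominated ρ := by
  by_contra h
  choose Y hY hnorm hlt using fun n : ℕ =>
    exists_norm_eq_and_lt_of_not_dominated hρ h (r := (1 / 2) ^ n) (b := 2 ^ n)
      (by positivity) (by positivity)
  have hsum : Summable Y := Summable.of_norm (by simpa only [hnorm] using summable_geometric_two)
  have hbound (n : ℕ) : ((2 ^ n : ℝ) : EReal) < ρ (∑' k, Y k) :=
    (hlt n).trans_le (hρ.monotone _ _ (hsum.le_tsum n fun k _ => hY k))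
  obtain ⟨hbot, htop⟩ := hfin (∑' k, Y k)
  lift ρ (∑' k, Y k) to ℝ using ⟨htop, hbot⟩ with a
  obtain ⟨n, hn⟩ := pow_unbounded_of_one_lt a (one_lt_two (α := ℝ))
  exact hn.not_gt (by exact_mod_cast hbound n)

end CoherentRisk

theorem proposition3 {Ω : Type*} [MeasurableSpace Ω] (P : MeasureTheory.Measure Ω)
    [MeasureTheory.IsProbabilityMeasure P] (hP : CoherentRisk.IsAtomless P)
    (ρ : MeasureTheory.Lp ℝ 1 P → EReal) (hρ : CoherentRisk.IsCoherent ρ)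
    (hlaw : CoherentRisk.IsLawInvariant ρ) :
    CoherentRisk.IsFiniteOnL1 ρ ↔ CoherentRisk.IsExpectationDominated ρ := by
  exact ⟨hρ.isExpectationDominated_of_isFiniteOnL1, hρ.isFiniteOnL1_of_isExpectationDominated⟩
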